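/- A (countable) framework $(G,p)$ in $\mathbb{R}^2$ is a graph $G=(V,E)$ with countable vertex set together with points $p_v\in\mathbb{R}^2$ $(v\in V)$. A continuous flex of $(G,p)$ is a family of continuous functions $p_v:[0,1]\to\mathbb{R}^2$ $(v\in V)$ such that $p_v(0)=p_v$ for all $v$; $|p_v(t)-p_w(t)|=|p_v(0)-p_w(0)|$ for every edge $vw$ and every $t$; some edge $ab$ with $p_a\neq p_b$ is fixed, i.e. $p_a(t)=p_a(0)$ and $p_b(t)=p_b(0)$ for all $t$; and $p(t)$ is not constant. An infinite plane linkage is a framework $(G,p)$ with $V$ infinite and $G$ connected, together with a vertex $v_1$ of degree two, with edges $v_1v_2$, $v_1v_3$, and a continuous flex $p(t)$, such that (i) $g(t)=\langle p_{v_2}(t)-p_{v_1}(t),\,p_{v_3}(t)-p_{v_1}(t)\rangle$ is strictly increasing on $[0,1]$, and (ii) $p(t)$ is the only continuous flex $q(t)$ of $(G,p)$ with $q_{v_i}(t)=p_{v_i}(t)$ for $i=1,2,3$ and all $t$. **Theorem.** Every continuous planar curve has an infinite linkage realisation. That is, for every continuous $\gamma:[0,1]\to\mathbb{R}^2$ there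 are an infinite plane linkage with flex $p(t)$ as above and a vertex $w$ such that $p_w(t)=\gamma(t)$ for all $t\in[0,1]$. Moreover, the linkage can be chosen so that: $p_{v_1}(t)=(0,0)$ and $p_{v_2}(t)=p_{v_2}(0)$ for all $t$ (so the only input is the rotation of the bar $v_1v_3$ about the origin); every vertex other than $w$ has finite degree; and $w$ is a limit point of the linkage throughout the motion, i.e. there are pairwise distinct vertices $u_1,u_2,\dots$ with $p_{u_k}(t)\to p_w(t)$ for every $t\in[0,1]$. -/

import Mathlib

/-- A bar-joint framework in the Euclidean plane: an abstract (simple) graph together with a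
placement of its vertices. Distinct vertices may be placed at the same point. -/
structure Framework (V : Type*) where
  graph : SimpleGraph V
  pos : V → EuclideanSpace ℝ (Fin 2)

/-- A (proper) continuous flex `p(t)`, `t ∈ [0,1]`, of a framework. -/
structure Framework.IsContinuousFlex {V : Type*} (F : Framework V)
    (p : unitInterval → V → EuclideanSpace ℝ (Fin 2)) : Prop where
  /-- the flex starts at the given placement -/
  start : p 0 = F.pos
  /-- every vertex moves continuously -/
  continuous : ∀ v, Continuous fun t => p t v
  /-- some base edge of nonzero length stays where it is -/
  base : ∃ a b, F.graph.Adj a b ∧ F.pos a ≠ F.pos b ∧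
    ∀ t, p t a = p 0 a ∧ p t b = p 0 b
  /-- edge lengths are preserved -/
  edge : ∀ a b, F.graph.Adj a b → ∀ t, dist (p t a) (p t b) = dist (p 0 a) (p 0 b)
  /-- the flex is not constant -/
  nonconstant : ∃ t, p t ≠ p 0

/-- The framework `F`, with input vertices `v₁, v₂, v₃` and the continuous flex `p`, is a plane
linkage. -/
structure Framework.IsPlaneLinkage {V : Type*} (F : Framework V) (v₁ v₂ v₃ : V)
    (p : unitInterval → V → EuclideanSpace ℝ (Fin 2)) : Prop where
  connected : F.graph.Connected
  /-- `v₁` has degree two, with the edges `v₁v₂` and `v₁v₃` -/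
  ne : v₂ ≠ v₃
  neighborSet_eq : F.graph.neighborSet v₁ = {v₂, v₃}
  flex : F.IsContinuousFlex p
  /-- the cosine angle function is strictly increasing -/
  strictMono_angle : StrictMono fun t => inner ℝ (p t v₂ - p t v₁) (p t v₃ - p t v₁)
  /-- the motion of the three input vertices determines the flex -/
  unique : ∀ q : unitInterval → V → EuclideanSpace ℝ (Fin 2), F.IsContinuousFlex q →
    (∀ t, q t v₁ = p t v₁ ∧ q t v₂ = p t v₂ ∧ q t v₃ = p t v₃) → q = p

/-!
The plane is identified with `ℂ`, and the inputs are the points `0`, `1` and `z(t)`, where `z(t)` is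
the point of the upper unit semicircle with abscissa `t / 2`.

A finite linkage can be extended by a point on the line of two vertices at constant distance, by the
fourth corner of a parallelogram of bars with a brace between two midpoints, and by a dyad, that is,
by a vertex joined to two moving vertices with which it is never collinear. In the first two cases
the new positions are forced at every single time (`eq_of_dist_eq_lineMap`, `eq_of_braced`), in the
third one by continuity (`eq_of_dist_eq_of_im_ne_zero`). A rod is a bar turning about `0`.
Parallelograms carry rods along chains of rods, so every element of their real span `rodSpan` can be
drawn (`drawable_of_mem_rodSpan`).

For `P ∈ rodSpan` without zeros, the two mirrored dyads with bars of lengths `r₁ ≠ r₂` on `0` and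
`P` are rods, and their sum is `P + (r₁² - r₂²) / conj P`. Thus `rodSpan` is closed under the
inversion `P ↦ 1 / conj P` (`inversion_mem_rodSpan`). As `z` has norm one, two inversions applied
to `1 + z` give `conj z ∈ rodSpan`, hence the real and imaginary parts of `z`. The real functions
`h` with `h ∈ rodSpan`, or with `h i ∈ rodSpan`, form a vector space closed under `h ↦ 1 / h` for
`h > 0`; by Hua's identity it is an algebra (`mul_mem_of_inv_mem`), and it contains an injective
function. By the Stone–Weierstrass theorem, `rodSpan` is dense in the space of all curves
(`exists_mem_rodSpan_near`).

Given a curve `c`, choose radii `r k → 0` and finite linkages with outputs `f k` at distance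
strictly between `0` and `2 r k` from `c` (by approximating `c + r k`). Then `c` can be joined to
`f k` by two bars of length `r k`, never collinear, which meet in an elbow. The vertex moving along `c` is
determined as the limit of the outputs, and each elbow by continuity
(`Approximation.rigid_of_adj`). To keep all degrees but one finite, the finite linkages form a
chain, each receiving its inputs from the previous one by flat triangles of bars. Connectedness need
not be tracked, being a consequence of the uniqueness of the flex (`PlanarLinkage.connected`).
-/

/-! ### Moving points and the input -/

/-- A moving point of the plane, the plane being identified with `ℂ`. -/
abbrev Curve := C(unitInterval, ℂ)

/-- Two moving points can be joined by a bar: their distance does not change. As in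
`Framework`, the two points may coincide. -/
def IsBar (a b : Curve) : Prop := ∀ t, dist (a t) (b t) = dist (a 0) (b 0)

/-- The motion of the input vertex `v₃`: it stays on the upper unit semicircle, its abscissa
being `t / 2` at time `t`. -/
noncomputable def inputCurve : Curve where
  toFun t := ⟨(t : ℝ) / 2, √(1 - ((t : ℝ) / 2) ^ 2)⟩
  continuous_toFun := by
    have : (fun t : unitInterval => (⟨(t : ℝ) / 2, √(1 - ((t : ℝ) / 2) ^ 2)⟩ : ℂ)) =
        fun t : unitInterval => (((t : ℝ) / 2 : ℝ) : ℂ) +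
          ((√(1 - ((t : ℝ) / 2) ^ 2) : ℝ) : ℂ) * Complex.I := by
      funext t
      exact Complex.mk_eq_add_mul_I _ _
    rw [this]
    fun_prop

theorem inputCurve_re (t : unitInterval) : (inputCurve t).re = (t : ℝ) / 2 := rfl

theorem inputCurve_im (t : unitInterval) :
    (inputCurve t).im = √(1 - ((t : ℝ) / 2) ^ 2) := rfl

theorem inputCurve_im_sq (t : unitInterval) :
    (inputCurve t).im ^ 2 = 1 - ((t : ℝ) / 2) ^ 2 := by
  rw [inputCurve_im, Real.sq_sqrt]
  nlinarith [t.2.1, t.2.2]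

theorem inputCurve_im_pos (t : unitInterval) : 0 < (inputCurve t).im := by
  rw [inputCurve_im]
  apply Real.sqrt_pos.2
  nlinarith [t.2.1, t.2.2]

theorem normSq_inputCurve (t : unitInterval) : Complex.normSq (inputCurve t) = 1 := by
  rw [Complex.normSq_apply, inputCurve_re]
  linear_combination inputCurve_im_sq t

theorem norm_inputCurve (t : unitInterval) : ‖inputCurve t‖ = 1 := by
  rw [Complex.norm_def, normSq_inputCurve, Real.sqrt_one]

/-! ### Finite linkages and their extensions -/

/-- A bar-joint linkage moving in the plane, with three input vertices at `0`, at `1` and at the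
moving point `inputCurve`, whose motion determines the motion of all other vertices. The bars are
given by a relation, read as unoriented. -/
structure PlanarLinkage (V : Type) where
  adj : V → V → Prop
  curve : V → Curve
  origin : V
  unit : V
  input : V
  curve_origin : curve origin = 0
  curve_unit : curve unit = 1
  curve_input : curve input = inputCurve
  bar : ∀ u v, adj u v → IsBar (curve u) (curve v)
  rigid : ∀ q : V → Curve, (∀ v, q v 0 = curve v 0) →
    (∀ u v, adj u v → ∀ t, dist (q u t) (q v t) = dist (curve u t) (curve v t)) →
    q origin = curve origin → q unit = curve unit → q input = curve input → q = curve

/-- New vertices may be attached to a linkage as soon as their motion is determined by the bars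
among themselves and to the old vertices. -/
def PlanarLinkage.extend {V W : Type} (L : PlanarLinkage V) (r : W → Curve) (E₁ : W → V → Prop)
    (E₂ : W → W → Prop) (h₁ : ∀ w v, E₁ w v → IsBar (r w) (L.curve v))
    (h₂ : ∀ w w', E₂ w w' → IsBar (r w) (r w'))
    (hr : ∀ q : W → Curve, (∀ w, q w 0 = r w 0) →
      (∀ w v, E₁ w v → ∀ t, dist (q w t) (L.curve v t) = dist (r w t) (L.curve v t)) →
      (∀ w w', E₂ w w' → ∀ t, dist (q w t) (q w' t) = dist (r w t) (r w' t)) → q = r) :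
    PlanarLinkage (V ⊕ W) where
  adj
    | .inl u, .inl v => L.adj u v
    | .inr w, .inl v => E₁ w v
    | .inr w, .inr w' => E₂ w w'
    | .inl _, .inr _ => False
  curve := Sum.elim L.curve r
  origin := .inl L.origin
  unit := .inl L.unit
  input := .inl L.input
  curve_origin := L.curve_origin
  curve_unit := L.curve_unit
  curve_input := L.curve_input
  bar := by
    rintro (u | w) (v | w') h
    · exact L.bar u v h
    · exact h.elim
    · exact h₁ w v h
    · exact h₂ w w' h
  rigid := by
    intro q h0 hd ho hu hi
    have hV : q ∘ Sum.inl = L.curve :=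
      L.rigid (q ∘ Sum.inl) (fun v => h0 (.inl v)) (fun u v h => hd (.inl u) (.inl v) h) ho hu hi
    have hV' : ∀ v, q (.inl v) = L.curve v := fun v => congrFun hV v
    have hW : q ∘ Sum.inr = r := by
      refine hr _ (fun w => h0 (.inr w)) (fun w v h t => ?_)
        (fun w w' h => hd (.inr w) (.inr w') h)
      have := hd (.inr w) (.inl v) h t
      rwa [hV' v] at this
    funext x
    rcases x with v | w
    · exact hV' v
    · exact congrFun hW w

/-- Some finite linkage draws all the curves in `F`. -/
def Realized (F : Set Curve) : Prop :=
  ∃ (V : Type) (_ : Finite V) (L : PlanarLinkage V), F ⊆ Set.range L.curve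

theorem Realized.mono {F G : Set Curve} (hG : Realized G) (h : F ⊆ G) : Realized F := by
  obtain ⟨V, hV, L, hL⟩ := hG
  exact ⟨V, hV, L, h.trans hL⟩

/-- The linkage consisting of the three input vertices alone. -/
theorem realized_empty : Realized ∅ := by
  refine ⟨Fin 3, inferInstance,
    { adj := fun _ _ => False
      curve := ![0, 1, inputCurve]
      origin := 0
      unit := 1
      input := 2
      curve_origin := rfl
      curve_unit := rfl
      curve_input := rfl
      bar := fun _ _ h => h.elim
      rigid := ?_ }, Set.empty_subset _⟩
  intro q _ _ h0 h1 h2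
  funext i
  fin_cases i
  · exact h0
  · exact h1
  · exact h2

theorem Realized.insert_base {F : Set Curve} (hF : Realized F) :
    Realized (insert 0 (insert 1 (insert inputCurve F))) := by
  obtain ⟨V, hV, L, hL⟩ := hF
  refine ⟨V, hV, L, ?_⟩
  rintro c (rfl | rfl | rfl | hc)
  · exact ⟨_, L.curve_origin⟩
  · exact ⟨_, L.curve_unit⟩
  · exact ⟨_, L.curve_input⟩
  · exact hL hc

/-- Attaching one vertex by two bars. -/
theorem Realized.insert_of_unique {F : Set Curve} (hF : Realized F) {a b c : Curve} (ha : a ∈ F)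
    (hb : b ∈ F) (hca : IsBar c a) (hcb : IsBar c b)
    (h : ∀ q : Curve, q 0 = c 0 → (∀ t, dist (q t) (a t) = dist (c t) (a t)) →
      (∀ t, dist (q t) (b t) = dist (c t) (b t)) → q = c) : Realized (insert c F) := by
  obtain ⟨V, hV, L, hL⟩ := hF
  obtain ⟨va, rfl⟩ := hL ha
  obtain ⟨vb, rfl⟩ := hL hb
  refine ⟨V ⊕ Unit, inferInstance, L.extend (fun _ => c) (fun _ v => v = va ∨ v = vb)
    (fun _ _ => False) ?_ (fun _ _ h => h.elim) ?_, ?_⟩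
  · rintro _ v (rfl | rfl)
    · exact hca
    · exact hcb
  · intro q h0 hd _
    funext w
    exact h (q w) (h0 w) (hd w va (.inl rfl)) (hd w vb (.inr rfl))
  · rintro d (rfl | hd)
    · exact ⟨.inr (), rfl⟩
    · obtain ⟨v, rfl⟩ := hL hd
      exact ⟨.inl v, rfl⟩

/-! ### Points on a bar, braced parallelograms and dyads -/

theorem dist_eq_iff_normSq {a b c d : ℂ} :
    dist a b = dist c d ↔ Complex.normSq (a - b) = Complex.normSq (c - d) := by
  rw [Complex.dist_eq, Complex.dist_eq, Complex.normSq_eq_norm_sq, Complex.normSq_eq_norm_sq,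
    sq_eq_sq₀ (norm_nonneg _) (norm_nonneg _)]

/-- A point of the line `ab` is determined by its distances from `a` and `b`. -/
theorem eq_of_dist_eq_lineMap {a b q : ℂ} {s : ℝ}
    (ha : dist q a = dist (a + s * (b - a)) a) (hb : dist q b = dist (a + s * (b - a)) b) :
    q = a + s * (b - a) := by
  rw [dist_eq_iff_normSq] at ha hb
  rw [← sub_eq_zero, ← Complex.normSq_eq_zero]
  simp only [Complex.normSq_apply, Complex.add_re, Complex.add_im, Complex.sub_re, Complex.sub_im,
    Complex.mul_re, Complex.mul_im, Complex.ofReal_re, Complex.ofReal_im] at ha hb ⊢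
  linear_combination (1 - s) * ha + s * hb

theorem Curve.eq_of_dist_eq_lineMap {a b c q : Curve} (s : ℝ) (hc : c = a + s • (b - a))
    (ha : ∀ t, dist (q t) (a t) = dist (c t) (a t))
    (hb : ∀ t, dist (q t) (b t) = dist (c t) (b t)) : q = c := by
  subst hc
  ext1 t
  simpa using _root_.eq_of_dist_eq_lineMap (s := s) (by simpa using ha t) (by simpa using hb t)

theorem Realized.insert_lineMap {F : Set Curve} (hF : Realized F) {a b : Curve} (ha : a ∈ F)
    (hb : b ∈ F) (hab : IsBar b a) (s : ℝ) : Realized (insert (a + s • (b - a)) F) := by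
  refine hF.insert_of_unique ha hb ?_ ?_ ?_
  · intro t
    have := hab t
    simp only [dist_eq_norm] at this
    simp [dist_eq_norm, this]
  · intro t
    have h : ∀ t, (a + s • (b - a)) t - b t = (s - 1) • (b t - a t) := by
      intro t
      simp
      ring
    have := hab t
    simp only [dist_eq_norm] at this
    rw [dist_eq_norm, dist_eq_norm, h, h, norm_smul, norm_smul, this]
  · exact fun q _ h1 h2 => Curve.eq_of_dist_eq_lineMap s rfl h1 h2

/-- A parallelogram `a b c d` with a brace joining the midpoints of `ab` and `cd` cannot flip:
`c - b` and `d - a` have the same length as their average, so they are equal. -/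
theorem eq_of_braced {a b c d m : ℂ} (hcb : dist c b = dist (b + d - a) b)
    (hcd : dist c d = dist (b + d - a) d) (hmc : dist m c = dist (d + (b - a) / 2) (b + d - a))
    (hmd : dist m d = dist (d + (b - a) / 2) d)
    (hm : dist m (a + (b - a) / 2) = dist (d + (b - a) / 2) (a + (b - a) / 2)) :
    c = b + d - a ∧ m = d + (b - a) / 2 := by
  have hmid : m = d + ((1 / 2 : ℝ) : ℂ) * (c - d) := by
    apply eq_of_dist_eq_lineMap
    · rw [hmd, dist_eq_norm, dist_eq_norm]
      have : b + d - a - d = b - a := by ring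
      rw [dist_eq_norm, dist_eq_norm, this] at hcd
      simp [hcd, inv_mul_eq_div]
    · have e : d + ((1 / 2 : ℝ) : ℂ) * (c - d) - c = -((c - d) / 2) := by push_cast; ring
      have e' : d + (b - a) / 2 - (b + d - a) = -((b + d - a - d) / 2) := by ring
      rw [dist_eq_norm, dist_eq_norm] at hcd
      rw [hmc, dist_eq_norm, dist_eq_norm, e, e', norm_neg, norm_neg, norm_div, norm_div, hcd]
  have hc : c = b + d - a := by
    rw [← sub_eq_zero, ← Complex.normSq_eq_zero]
    rw [hmid, dist_eq_iff_normSq] at hm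
    rw [dist_eq_iff_normSq] at hcb
    simp only [Complex.normSq_apply, Complex.add_re, Complex.add_im, Complex.sub_re,
      Complex.sub_im, Complex.mul_re, Complex.mul_im, Complex.ofReal_re, Complex.ofReal_im,
      Complex.div_ofNat_re, Complex.div_ofNat_im] at hm hcb ⊢
    linear_combination 2 * hcb - 4 * hm
  refine ⟨hc, ?_⟩
  rw [hmid, hc]
  push_cast
  ring

theorem Realized.insert_parallelogram {F : Set Curve} (hF : Realized F) {a b d : Curve}
    (ha : a ∈ F) (hb : b ∈ F) (hd : d ∈ F) (hab : IsBar b a) (hda : IsBar d a) :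
    Realized (insert (b + d - a) F) := by
  have hmF := hF.insert_lineMap ha hb hab (1 / 2)
  obtain ⟨V, hV, L, hL⟩ := hmF
  obtain ⟨vb, hvb⟩ := hL (Set.mem_insert_of_mem _ hb)
  obtain ⟨vd, hvd⟩ := hL (Set.mem_insert_of_mem _ hd)
  obtain ⟨vm, hvm⟩ := hL (Set.mem_insert _ _)
  have em : ∀ t, (a + (1 / 2 : ℝ) • (b - a)) t = a t + (b t - a t) / 2 := by
    intro t
    simp
    ring
  have em' : ∀ t, (d + (1 / 2 : ℝ) • (b - a)) t = d t + (b t - a t) / 2 := by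
    intro t
    simp
    ring
  have hb1 : IsBar (b + d - a) b := by
    intro t
    have e : ∀ t, (b + d - a) t - b t = d t - a t := by
      intro t
      simp
      ring
    have := hda t
    simp only [dist_eq_norm] at this ⊢
    rw [e, e, this]
  have hb2 : IsBar (b + d - a) d := by
    intro t
    have e : ∀ t, (b + d - a) t - d t = b t - a t := by
      intro t
      simp
      ring
    have := hab t
    simp only [dist_eq_norm] at this ⊢
    rw [e, e, this]
  have hb3 : IsBar (d + (1 / 2 : ℝ) • (b - a)) (b + d - a) := by
    intro t
    have e : ∀ t, (d + (1 / 2 : ℝ) • (b - a)) t - (b + d - a) t = -((b t - a t) / 2) := by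
      intro t
      rw [em']
      simp
      ring
    have := hab t
    simp only [dist_eq_norm] at this ⊢
    rw [e, e, norm_neg, norm_neg, norm_div, norm_div, this]
  have hb4 : IsBar (d + (1 / 2 : ℝ) • (b - a)) d := by
    intro t
    have := hab t
    simp only [dist_eq_norm] at this ⊢
    rw [em', em', add_sub_cancel_left, add_sub_cancel_left, norm_div, norm_div, this]
  have hb5 : IsBar (d + (1 / 2 : ℝ) • (b - a)) (a + (1 / 2 : ℝ) • (b - a)) := by
    intro t
    have := hda t
    simp only [dist_eq_norm] at this ⊢
    rw [em', em', em, em, add_sub_add_right_eq_sub, add_sub_add_right_eq_sub, this]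
  -- `true` is the fourth corner, `false` the midpoint of the side joining it to `d`
  refine ⟨V ⊕ Bool, inferInstance, L.extend
    (fun w => if w then b + d - a else d + (1 / 2 : ℝ) • (b - a))
    (fun w v => (w = true ∧ (v = vb ∨ v = vd)) ∨ (w = false ∧ (v = vd ∨ v = vm)))
    (fun w w' => w = false ∧ w' = true) ?_ ?_ ?_, ?_⟩
  · rintro w v (⟨rfl, rfl | rfl⟩ | ⟨rfl, rfl | rfl⟩)
    · simpa [hvb] using hb1
    · simpa [hvd] using hb2
    · simpa [hvd] using hb4
    · simpa [hvm] using hb5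
  · rintro w w' ⟨rfl, rfl⟩
    simpa using hb3
  · intro q _ h1 h2
    have key : ∀ t, q true t = b t + d t - a t ∧ q false t = d t + (b t - a t) / 2 := by
      intro t
      have k1 := h1 true vb (by simp) t
      have k2 := h1 true vd (by simp) t
      have k3 := h1 false vd (by simp) t
      have k4 := h1 false vm (by simp) t
      have k5 := h2 false true (by simp) t
      simp only [hvb, hvd, hvm, em, em', if_true, Bool.false_eq_true, if_false,
        ContinuousMap.sub_apply, ContinuousMap.add_apply] at k1 k2 k3 k4 k5
      exact eq_of_braced k1 k2 k5 k3 k4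
    funext w
    ext1 t
    cases w
    · exact (key t).2.trans (em' t).symm
    · simpa using (key t).1
  · rintro c (rfl | hc)
    · exact ⟨.inr true, rfl⟩
    · obtain ⟨v, hv⟩ := hL (Set.mem_insert_of_mem _ hc)
      exact ⟨.inl v, hv⟩

/-- A vertex joined by two bars to moving points `a` and `b` cannot jump to its mirror image in
the line `ab` as long as it does not cross this line. -/
theorem eq_of_dist_eq_of_im_ne_zero {a b c q : Curve} (h0 : q 0 = c 0)
    (ha : ∀ t, dist (q t) (a t) = dist (c t) (a t))
    (hb : ∀ t, dist (q t) (b t) = dist (c t) (b t))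
    (hne : ∀ t, ((starRingEnd ℂ (b t - a t)) * (c t - a t)).im ≠ 0) : q = c := by
  have hre : ∀ t, ((starRingEnd ℂ (b t - a t)) * (q t - a t)).re =
      ((starRingEnd ℂ (b t - a t)) * (c t - a t)).re := by
    intro t
    have h1 := dist_eq_iff_normSq.1 (ha t)
    have h2 := dist_eq_iff_normSq.1 (hb t)
    simp only [Complex.normSq_apply, Complex.mul_re, Complex.conj_re, Complex.conj_im,
      Complex.sub_re, Complex.sub_im] at h1 h2 ⊢
    linear_combination (h1 - h2) / 2
  have hsq : ∀ t, ((starRingEnd ℂ (b t - a t)) * (q t - a t)).im ^ 2 =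
      ((starRingEnd ℂ (b t - a t)) * (c t - a t)).im ^ 2 := by
    intro t
    have h1 := dist_eq_iff_normSq.1 (ha t)
    have h2 := congrArg (fun x => Complex.normSq (starRingEnd ℂ (b t - a t)) * x) h1
    simp only [← Complex.normSq_mul] at h2
    rw [Complex.normSq_apply, Complex.normSq_apply, hre t] at h2
    linear_combination h2
  have him := isPreconnected_univ.eq_of_sq_eq (S := (Set.univ : Set unitInterval))
    (f := fun t => ((starRingEnd ℂ (b t - a t)) * (q t - a t)).im)
    (g := fun t => ((starRingEnd ℂ (b t - a t)) * (c t - a t)).im)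
    (by fun_prop) (by fun_prop) (fun t _ => hsq t) (fun {t} _ => hne t) (Set.mem_univ 0)
    (by simp only [h0])
  ext1 t
  have h1 : (starRingEnd ℂ (b t - a t)) * (q t - a t) =
      (starRingEnd ℂ (b t - a t)) * (c t - a t) :=
    Complex.ext (hre t) (him (Set.mem_univ t))
  have h2 : starRingEnd ℂ (b t - a t) ≠ 0 := by
    intro h
    apply hne t
    rw [h, zero_mul, Complex.zero_im]
  simpa using mul_left_cancel₀ h2 h1

/-! ### Drawable curves and sums of rods -/

/-- The curve `c` can be drawn by adding finitely many vertices to any finite linkage, all curves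
that the linkage draws being kept. -/
def Drawable (c : Curve) : Prop := ∀ F, Realized F → Realized (insert c F)

theorem drawable_zero : Drawable 0 := fun _ hF =>
  hF.insert_base.mono (Set.insert_subset_insert
    ((Set.subset_insert _ _).trans (Set.subset_insert _ _)))

theorem drawable_one : Drawable 1 := fun _ hF =>
  hF.insert_base.mono ((Set.insert_subset_insert (Set.subset_insert _ _)).trans
    (Set.subset_insert _ _))

theorem drawable_inputCurve : Drawable inputCurve := fun _ hF =>
  hF.insert_base.mono ((Set.subset_insert _ _).trans (Set.subset_insert _ _))

theorem Drawable.realized {c : Curve} (hc : Drawable c) : Realized {c} :=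
  (hc _ realized_empty).mono (by simp)

theorem Drawable.parallelogram {a b d : Curve} (ha : Drawable a) (hb : Drawable b)
    (hd : Drawable d) (hba : IsBar b a) (hda : IsBar d a) : Drawable (b + d - a) := fun F hF =>
  ((hd _ (hb _ (ha _ hF))).insert_parallelogram (a := a) (b := b) (d := d)
    (by simp) (by simp) (by simp) hba hda).mono (Set.insert_subset_insert
      (((Set.subset_insert _ _).trans (Set.subset_insert _ _)).trans (Set.subset_insert _ _)))

/-- A bar pinned at the origin: its other end is drawable and stays on a circle about `0`. -/
structure IsRod (e : Curve) : Prop where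
  norm_eq : ∀ t, ‖e t‖ = ‖e 0‖
  drawable : Drawable e

theorem IsRod.smul {e : Curve} (he : IsRod e) (s : ℝ) : IsRod (s • e) where
  norm_eq t := by simp [he.norm_eq t]
  drawable F hF := by
    have := ((he.drawable _ (drawable_zero _ hF)).insert_lineMap (a := 0) (b := e) (by simp)
      (by simp) (fun t => by simpa using he.norm_eq t) s)
    refine this.mono ?_
    rw [sub_zero, zero_add]
    exact Set.insert_subset_insert ((Set.subset_insert _ _).trans (Set.subset_insert _ _))

theorem isRod_one : IsRod 1 := ⟨fun t => by simp, drawable_one⟩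

theorem isRod_inputCurve : IsRod inputCurve :=
  ⟨fun t => by rw [norm_inputCurve, norm_inputCurve], drawable_inputCurve⟩

/-- The finite sums of rods, regarded as moving vectors. -/
noncomputable def rodSpan : Submodule ℝ Curve := Submodule.span ℝ {e | IsRod e}

theorem IsRod.mem {e : Curve} (he : IsRod e) : e ∈ rodSpan := Submodule.subset_span he

/-- A sum of rods is drawable: a rod is carried along the chain formed by the others by a row of
braced parallelograms. -/
theorem drawable_of_mem_rodSpan {P : Curve} (hP : P ∈ rodSpan) : Drawable P := by
  have : Drawable P ∧ ∀ e, IsRod e → Drawable (P + e) := by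
    rw [rodSpan, ← Submodule.mem_toAddSubmonoid, Submodule.span_eq_closure] at hP
    induction hP using AddSubmonoid.closure_induction_right with
    | zero => exact ⟨drawable_zero, fun e he => by rw [zero_add]; exact he.drawable⟩
    | add_right Q _ e he ih =>
      obtain ⟨s, -, e, he, rfl⟩ := he
      have he : IsRod (s • e) := IsRod.smul he s
      refine ⟨ih.2 _ he, fun f hf => ?_⟩
      have h := ih.1.parallelogram (ih.2 _ he) (ih.2 _ hf)
        (fun t => by simpa using he.norm_eq t) (fun t => by simpa using hf.norm_eq t)
      have e' : Q + s • e + (Q + f) - Q = Q + s • e + f := by abel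
      rwa [e'] at h
  exact this.1

theorem isRod_of_dyad {P e : Curve} (hP : P ∈ rodSpan) (he : ∀ t, ‖e t‖ = ‖e 0‖)
    (heP : IsBar e P) (hne : ∀ t, ((starRingEnd ℂ (P t)) * e t).im ≠ 0) : IsRod e where
  norm_eq := he
  drawable F hF := by
    refine (Realized.insert_of_unique (drawable_of_mem_rodSpan hP _ (drawable_zero _ hF))
      (a := 0) (b := P) (c := e) (by simp) (by simp) ?_ heP ?_).mono ?_
    · exact fun t => by simpa using he t
    · intro q h0 h1 h2
      exact eq_of_dist_eq_of_im_ne_zero h0 h1 h2 (by simpa using hne)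
    · exact Set.insert_subset_insert ((Set.subset_insert _ _).trans (Set.subset_insert _ _))

/-! ### Inversion -/

/-- Two circles, of radii `r₁` about `0` and `r₂` about the moving point `P`, which meet in two
points at all times, do so along two curves, mirror images in the line through `0` and `P`. -/
theorem exists_dyad (P : Curve) (r₁ r₂ : ℝ) (h₀ : 0 ≤ r₁) (h₁ : ∀ t, |‖P t‖ - r₁| < r₂)
    (h₂ : ∀ t, r₂ < ‖P t‖ + r₁) (hP : ∀ t, P t ≠ 0) :
    ∃ e e' : Curve, (∀ t, ‖e t‖ = r₁ ∧ ‖e t - P t‖ = r₂ ∧ ((starRingEnd ℂ (P t)) * e t).im ≠ 0) ∧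
      (∀ t, ‖e' t‖ = r₁ ∧ ‖e' t - P t‖ = r₂ ∧ ((starRingEnd ℂ (P t)) * e' t).im ≠ 0) ∧
      ∀ t, e t + e' t = P t + ((r₁ ^ 2 - r₂ ^ 2 : ℝ) : ℂ) * (starRingEnd ℂ (P t))⁻¹ := by
  have hn : ∀ t, 0 < Complex.normSq (P t) := fun t => Complex.normSq_pos.2 (hP t)
  have hcN : Continuous fun t => Complex.normSq (P t) := Complex.continuous_normSq.comp P.continuous
  -- in the frame given by `P` and `i P` the two points have coordinates `α` and `± β`
  let α : unitInterval → ℝ := fun t =>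
    (r₁ ^ 2 - r₂ ^ 2 + Complex.normSq (P t)) / (2 * Complex.normSq (P t))
  let β : unitInterval → ℝ := fun t => √(r₁ ^ 2 / Complex.normSq (P t) - α t ^ 2)
  have hα : Continuous α := by
    refine Continuous.div (by fun_prop) (by fun_prop) fun t => ?_
    have := hn t
    positivity
  have hβ : Continuous β := by
    refine Real.continuous_sqrt.comp (Continuous.sub (Continuous.div (by fun_prop) hcN fun t => ?_)
      (by fun_prop))
    exact (hn t).ne'
  have hpos : ∀ t, 0 < r₁ ^ 2 / Complex.normSq (P t) - α t ^ 2 := by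
    intro t
    have hN := hn t
    have h1 := abs_lt.1 (h₁ t)
    have h2 := h₂ t
    have hr : 0 < r₂ := (abs_nonneg _).trans_lt (h₁ t)
    have hnorm : 0 ≤ ‖P t‖ := norm_nonneg _
    have e : r₁ ^ 2 / Complex.normSq (P t) - α t ^ 2 =
        ((r₂ - (‖P t‖ - r₁)) * (r₂ + (‖P t‖ - r₁)) *
          ((‖P t‖ + r₁ - r₂) * (‖P t‖ + r₁ + r₂))) / (2 * Complex.normSq (P t)) ^ 2 := by
      simp only [α]
      field_simp
      rw [Complex.normSq_eq_norm_sq]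
      ring
    rw [e]
    have a1 : 0 < r₂ - (‖P t‖ - r₁) := by linarith
    have a2 : 0 < r₂ + (‖P t‖ - r₁) := by linarith
    have a3 : 0 < ‖P t‖ + r₁ - r₂ := by linarith
    have a4 : 0 < ‖P t‖ + r₁ + r₂ := by linarith
    positivity
  have hβsq : ∀ t, β t ^ 2 = r₁ ^ 2 / Complex.normSq (P t) - α t ^ 2 := fun t =>
    Real.sq_sqrt (hpos t).le
  have hβpos : ∀ t, 0 < β t := fun t => Real.sqrt_pos.2 (hpos t)
  have key : ∀ (t : unitInterval) (b : ℝ), b ^ 2 = β t ^ 2 → b ≠ 0 →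
      ‖P t * ⟨α t, b⟩‖ = r₁ ∧ ‖P t * ⟨α t, b⟩ - P t‖ = r₂ ∧
        ((starRingEnd ℂ (P t)) * (P t * ⟨α t, b⟩)).im ≠ 0 := by
    intro t b hb hb0
    have hN := (hn t).ne'
    have hr : 0 < r₂ := (abs_nonneg _).trans_lt (h₁ t)
    rw [hβsq] at hb
    have hα' : 2 * Complex.normSq (P t) * α t = r₁ ^ 2 - r₂ ^ 2 + Complex.normSq (P t) := by
      simp only [α]
      field_simp
    have hb' : Complex.normSq (P t) * (α t ^ 2 + b ^ 2) = r₁ ^ 2 := by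
      rw [hb]
      field_simp
      ring
    refine ⟨?_, ?_, ?_⟩
    · rw [← sq_eq_sq₀ (norm_nonneg _) h₀, ← Complex.normSq_eq_norm_sq, Complex.normSq_mul,
        Complex.normSq_mk (α t) b]
      linear_combination hb'
    · have e : P t * ⟨α t, b⟩ - P t = P t * ⟨α t - 1, b⟩ := by
        apply Complex.ext <;> simp <;> ring
      rw [e, ← sq_eq_sq₀ (norm_nonneg _) hr.le, ← Complex.normSq_eq_norm_sq, Complex.normSq_mul,
        Complex.normSq_mk (α t - 1) b]
      linear_combination hb' - hα'
    · rw [← mul_assoc, mul_comm (starRingEnd ℂ (P t)), Complex.mul_conj, Complex.im_ofReal_mul]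
      exact mul_ne_zero hN hb0
  have hmk : ∀ b : unitInterval → ℝ, Continuous b →
      Continuous fun t => P t * (⟨α t, b t⟩ : ℂ) := by
    intro b hb
    have e : (fun t => P t * (⟨α t, b t⟩ : ℂ)) =
        fun t => P t * ((α t : ℂ) + (b t : ℂ) * Complex.I) := by
      funext t
      rw [Complex.mk_eq_add_mul_I]
    rw [e]
    fun_prop
  refine ⟨⟨_, hmk β hβ⟩, ⟨_, hmk (fun t => -β t) hβ.neg⟩,
    fun t => key t _ rfl (hβpos t).ne', fun t => key t _ (neg_sq _) (neg_ne_zero.2 (hβpos t).ne'),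
    fun t => ?_⟩
  have hc : starRingEnd ℂ (P t) ≠ 0 := (map_ne_zero _).2 (hP t)
  have e : (⟨α t, β t⟩ : ℂ) + ⟨α t, -β t⟩ = ((2 * α t : ℝ) : ℂ) := by
    apply Complex.ext <;> simp
    ring
  have e2 : (Complex.normSq (P t) : ℂ) * ((2 * α t : ℝ) : ℂ) =
      ((r₁ ^ 2 - r₂ ^ 2 : ℝ) : ℂ) + Complex.normSq (P t) := by
    rw [← Complex.ofReal_mul, ← Complex.ofReal_add]
    congr 1
    have hN := (hn t).ne'
    simp only [α]
    field_simp
  simp only [ContinuousMap.coe_mk]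
  rw [← mul_add, e]
  apply mul_left_cancel₀ hc
  rw [mul_add, mul_left_comm _ _ (_)⁻¹, mul_inv_cancel₀ hc, mul_one, ← mul_assoc,
    mul_comm (starRingEnd ℂ (P t)), Complex.mul_conj, e2]
  ring

/-- Inversion in the unit circle: the sum of two mirrored dyads on `0` and `P`, with bars of
different lengths `r₁ > r₂`, is `P + (r₁² - r₂²) / conj P`. -/
theorem inversion_mem_rodSpan {P Q : Curve} (hP : P ∈ rodSpan) (h0 : ∀ t, P t ≠ 0)
    (hQ : ∀ t, Q t = (starRingEnd ℂ (P t))⁻¹) : Q ∈ rodSpan := by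
  have hc : Continuous fun t => ‖P t‖ := by fun_prop
  obtain ⟨t₀, -, ht₀⟩ := isCompact_univ.exists_isMinOn (Set.univ_nonempty) hc.continuousOn
  obtain ⟨t₁, -, ht₁⟩ := isCompact_univ.exists_isMaxOn (Set.univ_nonempty) hc.continuousOn
  set m := ‖P t₀‖ with hm
  set M := ‖P t₁‖ with hM
  have hmin : ∀ t, m ≤ ‖P t‖ := fun t => ht₀ (Set.mem_univ t)
  have hmax : ∀ t, ‖P t‖ ≤ M := fun t => ht₁ (Set.mem_univ t)
  have hm0 : 0 < m := norm_pos_iff.2 (h0 t₀)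
  have hmM : m ≤ M := hmin t₁
  obtain ⟨e, e', he, he', hs⟩ := exists_dyad P (M + m / 2) M (by linarith)
    (fun t => by have := hmin t; have := hmax t; rw [abs_lt]; constructor <;> linarith)
    (fun t => by have := hmin t; linarith) h0
  have rod : ∀ e : Curve, (∀ t, ‖e t‖ = M + m / 2 ∧ ‖e t - P t‖ = M ∧
      ((starRingEnd ℂ (P t)) * e t).im ≠ 0) → e ∈ rodSpan := fun e he =>
    (isRod_of_dyad hP (fun t => by rw [(he t).1, (he 0).1])
      (fun t => by rw [dist_eq_norm, dist_eq_norm, (he t).2.1, (he 0).2.1])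
      fun t => (he t).2.2).mem
  have hk : ((M + m / 2) ^ 2 - M ^ 2 : ℝ) ≠ 0 := by nlinarith
  have hQ' : Q = ((M + m / 2) ^ 2 - M ^ 2 : ℝ)⁻¹ • (e + e' - P) := by
    ext1 t
    rw [ContinuousMap.smul_apply, ContinuousMap.sub_apply, ContinuousMap.add_apply, hs, hQ,
      add_sub_cancel_left, Complex.real_smul, Complex.ofReal_inv,
      inv_mul_cancel_left₀ (Complex.ofReal_ne_zero.2 hk)]
  rw [hQ']
  exact rodSpan.smul_mem _ (rodSpan.sub_mem (rodSpan.add_mem (rod e he) (rod e' he')) hP)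

theorem I_mem_rodSpan : ContinuousMap.const unitInterval Complex.I ∈ rodSpan := by
  refine (isRod_of_dyad (P := 1) isRod_one.mem (fun t => rfl) (fun t => rfl) fun t => ?_).mem
  simp

theorem star_inputCurve_mem_rodSpan : star inputCurve ∈ rodSpan := by
  have hre : ∀ t, 0 < (1 + inputCurve t).re := by
    intro t
    rw [Complex.add_re, Complex.one_re, inputCurve_re]
    linarith [t.2.1]
  have hne : ∀ t, 1 + inputCurve t ≠ 0 := fun t h => by
    have := hre t
    rw [h, Complex.zero_re] at this
    exact this.false
  have hnec : ∀ t, 1 + starRingEnd ℂ (inputCurve t) ≠ 0 := fun t h => by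
    apply hne t
    have := congrArg (starRingEnd ℂ) h
    simpa using this
  have hz : ∀ t, inputCurve t * starRingEnd ℂ (inputCurve t) = 1 := fun t => by
    rw [Complex.mul_conj, normSq_inputCurve, Complex.ofReal_one]
  -- as `z * conj z = 1`, the inverse of `1 + z` is `1 - (1 + conj z)⁻¹`
  have h1 : (⟨fun t => (1 + starRingEnd ℂ (inputCurve t))⁻¹,
      Continuous.inv₀ (by fun_prop) hnec⟩ : Curve) ∈ rodSpan :=
    inversion_mem_rodSpan (P := 1 + inputCurve)
      (rodSpan.add_mem isRod_one.mem isRod_inputCurve.mem) hne (fun t => by simp)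
  have e : ∀ t, (1 : ℂ) - (1 + starRingEnd ℂ (inputCurve t))⁻¹ = (1 + inputCurve t)⁻¹ := by
    intro t
    have a := hne t
    have b := hnec t
    field_simp
    linear_combination hz t
  have h2 := inversion_mem_rodSpan (Q := 1 + star inputCurve) (rodSpan.sub_mem isRod_one.mem h1)
    (fun t => by simpa [e] using hne t) (fun t => by simp [e])
  simpa using rodSpan.sub_mem h2 isRod_one.mem

/-! ### Density of the sums of rods -/

/-- A real vector space of functions which contains the constants and the inverses of its positive
members is closed under multiplication: for `0 < x < 1`, Hua's identity
`x² = x - (x⁻¹ + (1 - x)⁻¹)⁻¹` shows that it contains squares. -/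
theorem mul_mem_of_inv_mem {X : Type*} [TopologicalSpace X] [CompactSpace X]
    (H : Submodule ℝ C(X, ℝ)) (h1 : 1 ∈ H)
    (hinv : ∀ h ∈ H, (∀ t, 0 < h t) → ∀ g : C(X, ℝ), (∀ t, g t = (h t)⁻¹) → g ∈ H)
    {f g : C(X, ℝ)} (hf : f ∈ H) (hg : g ∈ H) : f * g ∈ H := by
  have hunit : ∀ x ∈ H, (∀ t, 0 < x t ∧ x t < 1) → x * x ∈ H := by
    intro x hx hx01
    have hpos : ∀ t, x t ≠ 0 := fun t => (hx01 t).1.ne'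
    have hpos' : ∀ t, 1 - x t ≠ 0 := fun t => (sub_pos.2 (hx01 t).2).ne'
    have i1 := hinv x hx (fun t => (hx01 t).1) ⟨fun t => (x t)⁻¹, x.continuous.inv₀ hpos⟩
      fun t => rfl
    have i2 := hinv (1 - x) (H.sub_mem h1 hx) (fun t => sub_pos.2 (hx01 t).2)
      ⟨fun t => (1 - x t)⁻¹, (continuous_const.sub x.continuous).inv₀ hpos'⟩ fun t => rfl
    have i3 := hinv _ (H.add_mem i1 i2)
      (fun t => add_pos (inv_pos.2 (hx01 t).1) (inv_pos.2 (sub_pos.2 (hx01 t).2)))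
      (x - x * x) (fun t => by
        have a := hpos t
        have b := hpos' t
        simp only [ContinuousMap.sub_apply, ContinuousMap.mul_apply, ContinuousMap.add_apply,
          ContinuousMap.coe_mk]
        field_simp
        ring)
    simpa using H.sub_mem hx i3
  have hsq : ∀ x ∈ H, x * x ∈ H := by
    intro x hx
    -- `y = (x + c) / (2 c)` takes its values in the open unit interval
    set c := ‖x‖ + 1 with hc
    have hc0 : 0 < c := by positivity
    have hxc : ∀ t, |x t| < c := fun t => (x.norm_coe_le_norm t).trans_lt (lt_add_one _)
    have hy : (2 * c)⁻¹ • (x + c • (1 : C(X, ℝ))) ∈ H :=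
      H.smul_mem _ (H.add_mem hx (H.smul_mem _ h1))
    have := hunit _ hy fun t => by
      have h := abs_lt.1 (hxc t)
      simp only [ContinuousMap.smul_apply, ContinuousMap.add_apply, ContinuousMap.one_apply,
        smul_eq_mul, mul_one]
      rw [inv_mul_eq_div]
      exact ⟨div_pos (by linarith) (by linarith), (div_lt_one (by linarith)).2 (by linarith)⟩
    have e : x * x = (4 * c ^ 2) • ((2 * c)⁻¹ • (x + c • (1 : C(X, ℝ))) *
        (2 * c)⁻¹ • (x + c • (1 : C(X, ℝ)))) - (2 * c) • x - (c ^ 2) • (1 : C(X, ℝ)) := by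
      ext t
      simp only [ContinuousMap.smul_apply, ContinuousMap.add_apply, ContinuousMap.one_apply,
        ContinuousMap.sub_apply, ContinuousMap.mul_apply, smul_eq_mul, mul_one]
      field_simp
      ring
    rw [e]
    exact H.sub_mem (H.sub_mem (H.smul_mem _ this) (H.smul_mem _ hx)) (H.smul_mem _ h1)
  have e : f * g = (1 / 2 : ℝ) • ((f + g) * (f + g) - f * f - g * g) := by
    ext t
    simp
    ring
  rw [e]
  exact H.smul_mem _ (H.sub_mem (H.sub_mem (hsq _ (H.add_mem hf hg)) (hsq _ hf)) (hsq _ hg))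

/-- The motion along the line through `0` in the direction `u` with coordinate function `h`. -/
def slider (u : ℂ) : C(unitInterval, ℝ) →ₗ[ℝ] Curve where
  toFun h := ⟨fun t => h t * u, by fun_prop⟩
  map_add' f g := by ext1 t; simp [add_mul]
  map_smul' c f := by ext1 t; simp [mul_assoc]

@[simp] theorem slider_apply (u : ℂ) (h : C(unitInterval, ℝ)) (t : unitInterval) :
    slider u h t = h t * u := rfl

/-- Along a fixed line, sums of rods approximate every motion: their coordinate functions form a
subalgebra, to which the Stone–Weierstrass theorem applies. -/
theorem exists_slider_near {u : ℂ} (hu : ‖u‖ = 1) (h1 : slider u 1 ∈ rodSpan)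
    (x : C(unitInterval, ℝ)) (hx : slider u x ∈ rodSpan) (hinj : Function.Injective x)
    (f : C(unitInterval, ℝ)) {ε : ℝ} (hε : 0 < ε) :
    ∃ g : C(unitInterval, ℝ), slider u g ∈ rodSpan ∧ ∀ t, |g t - f t| < ε := by
  have hu0 : u ≠ 0 := by
    rintro rfl
    simp at hu
  have hcu : (starRingEnd ℂ u)⁻¹ = u := by
    rw [inv_eq_iff_eq_inv, Complex.inv_def, Complex.normSq_eq_norm_sq, hu]
    simp
  let H : Submodule ℝ C(unitInterval, ℝ) := rodSpan.comap (slider u)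
  have hinv : ∀ h ∈ H, (∀ t, 0 < h t) → ∀ g : C(unitInterval, ℝ), (∀ t, g t = (h t)⁻¹) →
      g ∈ H := by
    intro h hh hpos g hg
    refine inversion_mem_rodSpan (P := slider u h) hh (fun t => ?_) (fun t => ?_)
    · exact mul_ne_zero (Complex.ofReal_ne_zero.2 (hpos t).ne') hu0
    · simp [hg, hcu, mul_comm]
  let A : Subalgebra ℝ C(unitInterval, ℝ) :=
    H.toSubalgebra h1 fun _ _ hf hg => mul_mem_of_inv_mem H h1 hinv hf hg
  have hA : A.SeparatesPoints := fun s t hst => ⟨x, ⟨x, hx, rfl⟩, fun h => hst (hinj h)⟩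
  obtain ⟨⟨g, hg⟩, hgf⟩ :=
    ContinuousMap.exists_mem_subalgebra_near_continuousMap_of_separatesPoints A hA f ε hε
  refine ⟨g, hg, fun t => ?_⟩
  exact ((g - f).norm_coe_le_norm t).trans_lt hgf

theorem exists_mem_rodSpan_near (c : Curve) {ε : ℝ} (hε : 0 < ε) :
    ∃ P ∈ rodSpan, ∀ t, ‖P t - c t‖ < ε := by
  let x : C(unitInterval, ℝ) := ⟨fun t => (inputCurve t).re, by fun_prop⟩
  let y : C(unitInterval, ℝ) := ⟨fun t => (inputCurve t).im, by fun_prop⟩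
  have hxt : ∀ t, x t = (inputCurve t).re := fun _ => rfl
  have hyt : ∀ t, y t = (inputCurve t).im := fun _ => rfl
  have hx : slider 1 x ∈ rodSpan := by
    have e : slider 1 x = (1 / 2 : ℝ) • (inputCurve + star inputCurve) := by
      ext1 t
      apply Complex.ext <;> simp [hxt]
      ring
    rw [e]
    exact rodSpan.smul_mem _ (rodSpan.add_mem isRod_inputCurve.mem star_inputCurve_mem_rodSpan)
  have hy : slider Complex.I y ∈ rodSpan := by
    have e : slider Complex.I y = inputCurve - slider 1 x := by
      ext1 t
      apply Complex.ext <;> simp [hxt, hyt]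
    rw [e]
    exact rodSpan.sub_mem isRod_inputCurve.mem hx
  have h1 : slider 1 1 ∈ rodSpan := by
    have e : slider 1 1 = 1 := by
      ext1 t
      simp
    rw [e]
    exact isRod_one.mem
  have hI : slider Complex.I 1 ∈ rodSpan := by
    have e : slider Complex.I 1 = ContinuousMap.const unitInterval Complex.I := by
      ext1 t
      simp
    rw [e]
    exact I_mem_rodSpan
  have hxinj : Function.Injective x := by
    intro s t h
    have h' : (s : ℝ) / 2 = (t : ℝ) / 2 := h
    exact Subtype.ext (by linarith)
  have hyinj : Function.Injective y := by
    intro s t h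
    have h' : (inputCurve s).im = (inputCurve t).im := h
    have := inputCurve_im_sq s
    rw [h', inputCurve_im_sq t] at this
    have h2 : (s : ℝ) ^ 2 = (t : ℝ) ^ 2 := by linarith
    exact Subtype.ext ((sq_eq_sq₀ s.2.1 t.2.1).1 h2)
  obtain ⟨g, hg, hgc⟩ := exists_slider_near norm_one h1 x hx hxinj
    ⟨fun t => (c t).re, by fun_prop⟩ (half_pos hε)
  obtain ⟨k, hk, hkc⟩ := exists_slider_near Complex.norm_I hI y hy hyinj
    ⟨fun t => (c t).im, by fun_prop⟩ (half_pos hε)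
  refine ⟨_, rodSpan.add_mem hg hk, fun t => ?_⟩
  refine (Complex.norm_le_abs_re_add_abs_im _).trans_lt ?_
  have a := hgc t
  have b := hkc t
  simp only [ContinuousMap.coe_mk] at a b
  simp only [ContinuousMap.add_apply, slider_apply, Complex.sub_re, Complex.sub_im,
    Complex.add_re, Complex.add_im, Complex.mul_re, Complex.mul_im, Complex.ofReal_re,
    Complex.ofReal_im, Complex.I_re, Complex.I_im, mul_one, mul_zero, sub_zero, add_zero,
    zero_add]
  linarith

/-! ### Two bars of equal length from approximating outputs to the curve -/

/-- Finite linkages `L k` with output vertices that approach the curve `c`, and for each `k` a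
curve `elbowCurve k`, never collinear with its two centres, which keeps the same distance `radius k`
from the output of `L k` as from `c`. -/
structure Approximation (c : Curve) where
  V : ℕ → Type
  finite : ∀ k, Finite (V k)
  L : ∀ k, PlanarLinkage (V k)
  out : ∀ k, V k
  elbowCurve : ℕ → Curve
  radius : ℕ → ℝ
  tendsto_radius : Filter.Tendsto radius Filter.atTop (nhds 0)
  dist_out : ∀ k t, dist (elbowCurve k t) ((L k).curve (out k) t) = radius k
  dist_target : ∀ k t, dist (elbowCurve k t) (c t) = radius k
  im_ne_zero : ∀ k t, ((starRingEnd ℂ (c t - (L k).curve (out k) t)) *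
    (elbowCurve k t - (L k).curve (out k) t)).im ≠ 0

theorem exists_approximation (c : Curve) : Nonempty (Approximation c) := by
  have step : ∀ k : ℕ, ∃ (V : Type) (_ : Finite V) (L : PlanarLinkage V) (out : V) (e : Curve),
      (∀ t, dist (e t) (L.curve out t) = 1 / ((k : ℝ) + 1)) ∧
      (∀ t, dist (e t) (c t) = 1 / ((k : ℝ) + 1)) ∧
      ∀ t, ((starRingEnd ℂ (c t - L.curve out t)) * (e t - L.curve out t)).im ≠ 0 := by
    intro k
    set r : ℝ := 1 / ((k : ℝ) + 1) with hr
    have hr0 : 0 < r := by positivity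
    -- approximating the translate `c + r` keeps the output at a distance in `[r / 2, 3 r / 2]`
    -- from `c`, so that it never meets `c` and two bars of length `r` reach
    obtain ⟨P, hP, hPc⟩ := exists_mem_rodSpan_near (c + ContinuousMap.const unitInterval (r : ℂ))
      (half_pos hr0)
    obtain ⟨V, hV, L, hL⟩ := (drawable_of_mem_rodSpan hP).realized
    obtain ⟨v, rfl⟩ := hL rfl
    have hnorm : ∀ t, |‖(c - L.curve v) t‖ - r| < r / 2 := by
      intro t
      have h := abs_norm_sub_norm_le ((c - L.curve v) t) (-(r : ℂ))
      have e : (c - L.curve v) t - -(r : ℂ) =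
          -(L.curve v t - (c + ContinuousMap.const unitInterval (r : ℂ)) t) := by
        simp
        ring
      rw [e, norm_neg, norm_neg, Complex.norm_real, Real.norm_of_nonneg hr0.le] at h
      exact h.trans_lt (hPc t)
    obtain ⟨d, -, hd, -⟩ := exists_dyad (c - L.curve v) r r hr0.le
      (fun t => (hnorm t).trans (half_lt_self hr0))
      (fun t => by have := abs_lt.1 (hnorm t); linarith)
      (fun t h => by
        have := abs_lt.1 (hnorm t)
        rw [h, norm_zero] at this
        linarith)
    refine ⟨V, hV, L, v, L.curve v + d, fun t => ?_, fun t => ?_, fun t => ?_⟩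
    · simpa [dist_eq_norm] using (hd t).1
    · rw [dist_eq_norm, ← (hd t).2.1]
      congr 1
      simp
      ring
    · simpa using (hd t).2.2
  choose V hV L out e h1 h2 h3 using step
  exact ⟨⟨V, hV, L, out, e, _, tendsto_one_div_add_atTop_nhds_zero_nat, h1, h2, h3⟩⟩

/-! ### The infinite linkage -/

/-- The vertices of the infinite linkage: the input vertex `pivot` of degree two, the vertex
`target` of infinite degree, the vertices of the blocks `V k`, the vertices `midUnit k` and
`midInput k` by which the inputs of a block are handed on to the next, and the vertices `elbow k`
which join the output of the block `V k` to the target. -/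
inductive ChainVertex (V : ℕ → Type) : Type
  | pivot
  | target
  | block (k : ℕ) (x : V k)
  | midUnit (k : ℕ)
  | midInput (k : ℕ)
  | elbow (k : ℕ)

namespace ChainVertex

/-- The index of the block to which a vertex belongs. -/
def level {V : ℕ → Type} : ChainVertex V → ℕ
  | pivot => 0
  | target => 0
  | block k _ => k
  | midUnit k => k
  | midInput k => k
  | elbow k => k

theorem finite_level_le {V : ℕ → Type} (hV : ∀ k, Finite (V k)) (n : ℕ) :
    {v : ChainVertex V | v.level ≤ n}.Finite := by
  have : ({pivot, target} ∪ ⋃ k ∈ Set.Iic n, (Set.range (block k) ∪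
      {midUnit k, midInput k, elbow k}) : Set (ChainVertex V)).Finite :=
    (Set.toFinite _).union ((Set.finite_Iic n).biUnion fun k _ => by
      have := hV k
      exact (Set.finite_range _).union (Set.toFinite _))
  refine this.subset ?_
  rintro (_ | _ | ⟨k, x⟩ | k | k | k) hv
  · simp
  · simp
  all_goals
    refine .inr (Set.mem_biUnion (show k ∈ Set.Iic n from hv) ?_)
    simp

theorem countable {V : ℕ → Type} (hV : ∀ k, Finite (V k)) : Countable (ChainVertex V) := by
  rw [← Set.countable_univ_iff]
  refine (Set.countable_iUnion fun n => (finite_level_le hV n).countable).mono fun v _ => ?_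
  exact Set.mem_iUnion.2 ⟨v.level, le_refl v.level⟩

end ChainVertex

namespace Approximation

open ChainVertex

variable {c : Curve} (A : Approximation c)

/-- The bars of the infinite linkage. The dyad on the vertices `1` and `inputCurve` of the first
block provides a second vertex at `0`, as the pivot is to have degree two. The
midpoints of the bars from `0` to `1` and from `0` to `inputCurve` in a block serve to construct the
same three points again in the next block. -/
inductive Adj : ChainVertex A.V → ChainVertex A.V → Prop
  | pivot_unit : Adj pivot (block 0 (A.L 0).unit)
  | pivot_input : Adj pivot (block 0 (A.L 0).input)
  | origin_unit : Adj (block 0 (A.L 0).origin) (block 0 (A.L 0).unit)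
  | origin_input : Adj (block 0 (A.L 0).origin) (block 0 (A.L 0).input)
  | block (k : ℕ) (x y : A.V k) (h : (A.L k).adj x y) : Adj (block k x) (block k y)
  | midUnit_origin (k : ℕ) : Adj (midUnit k) (block k (A.L k).origin)
  | midUnit_unit (k : ℕ) : Adj (midUnit k) (block k (A.L k).unit)
  | midInput_origin (k : ℕ) : Adj (midInput k) (block k (A.L k).origin)
  | midInput_input (k : ℕ) : Adj (midInput k) (block k (A.L k).input)
  | unit_origin (k : ℕ) : Adj (block (k + 1) (A.L (k + 1)).unit) (block k (A.L k).origin)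
  | unit_midUnit (k : ℕ) : Adj (block (k + 1) (A.L (k + 1)).unit) (midUnit k)
  | input_origin (k : ℕ) : Adj (block (k + 1) (A.L (k + 1)).input) (block k (A.L k).origin)
  | input_midInput (k : ℕ) : Adj (block (k + 1) (A.L (k + 1)).input) (midInput k)
  | origin_unit' (k : ℕ) : Adj (block (k + 1) (A.L (k + 1)).origin) (block k (A.L k).unit)
  | origin_midUnit (k : ℕ) : Adj (block (k + 1) (A.L (k + 1)).origin) (midUnit k)
  | elbow_out (k : ℕ) : Adj (elbow k) (block k (A.out k))
  | elbow_target (k : ℕ) : Adj (elbow k) target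

/-- The motion of the infinite linkage. -/
noncomputable def curve : ChainVertex A.V → Curve
  | pivot => 0
  | target => c
  | block k x => (A.L k).curve x
  | midUnit _ => (1 / 2 : ℝ) • 1
  | midInput _ => (1 / 2 : ℝ) • inputCurve
  | elbow k => A.elbowCurve k

theorem isBar_of_adj {u v : ChainVertex A.V} (h : A.Adj u v) : IsBar (A.curve u) (A.curve v) := by
  intro t
  have hz : ∀ t, ‖inputCurve t‖ = ‖inputCurve 0‖ := fun t => by
    rw [norm_inputCurve, norm_inputCurve]
  have e1 : (1 / 2 : ℝ) • (1 : Curve) - 1 = (-1 / 2 : ℝ) • (1 : Curve) := by module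
  have e2 : (1 / 2 : ℝ) • inputCurve - inputCurve = (-1 / 2 : ℝ) • inputCurve := by module
  have e3 : inputCurve - (1 / 2 : ℝ) • inputCurve = (1 / 2 : ℝ) • inputCurve := by module
  have key : ∀ a b d : Curve, a - b = d → (∀ t, ‖d t‖ = ‖d 0‖) →
      ∀ t, dist (a t) (b t) = dist (a 0) (b 0) := by
    rintro a b _ rfl h t
    rw [dist_eq_norm, dist_eq_norm]
    exact h t
  cases h with
  | block k x y h => exact (A.L k).bar x y h t
  | elbow_out k => simp only [curve]; rw [A.dist_out, A.dist_out]
  | elbow_target k => simp only [curve]; rw [A.dist_target, A.dist_target]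
  | _ =>
    simp only [curve, PlanarLinkage.curve_origin, PlanarLinkage.curve_unit,
      PlanarLinkage.curve_input]
    first
    | exact key _ _ _ e2 (fun t => by simp [hz t]) t
    | exact key _ _ _ e3 (fun t => by simp [hz t]) t
    | simp [hz t]

/-- The motion of the infinite linkage is determined by its inputs: these are handed on from block
to block, each block determines its output, and the target is the limit of the outputs. -/
theorem rigid_of_adj (q : ChainVertex A.V → Curve) (h0 : ∀ v, q v 0 = A.curve v 0)
    (hd : ∀ u v, A.Adj u v → ∀ t, dist (q u t) (q v t) = dist (A.curve u t) (A.curve v t))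
    (hp : q pivot = 0) (hu : q (block 0 (A.L 0).unit) = 1)
    (hi : q (block 0 (A.L 0).input) = inputCurve) : q = A.curve := by
  have bar : ∀ {u v} (_ : A.Adj u v) {a : Curve}, q v = a → A.curve v = a →
      ∀ t, dist (q u t) (a t) = dist (A.curve u t) (a t) := by
    intro u v h a h1 h2 t
    have := hd u v h t
    rwa [h1, h2] at this
  have hmu : ∀ k, q (block k (A.L k).origin) = 0 → q (block k (A.L k).unit) = 1 →
      q (midUnit k) = (1 / 2 : ℝ) • 1 := fun k ho hu =>
    Curve.eq_of_dist_eq_lineMap (a := 0) (b := 1) (1 / 2) (by module)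
      (bar (.midUnit_origin k) ho (A.L k).curve_origin)
      (bar (.midUnit_unit k) hu (A.L k).curve_unit)
  have hmi : ∀ k, q (block k (A.L k).origin) = 0 → q (block k (A.L k).input) = inputCurve →
      q (midInput k) = (1 / 2 : ℝ) • inputCurve := fun k ho hi =>
    Curve.eq_of_dist_eq_lineMap (a := 0) (b := inputCurve) (1 / 2) (by module)
      (bar (.midInput_origin k) ho (A.L k).curve_origin)
      (bar (.midInput_input k) hi (A.L k).curve_input)
  have base : ∀ k, q (block k (A.L k).origin) = 0 ∧ q (block k (A.L k).unit) = 1 ∧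
      q (block k (A.L k).input) = inputCurve := by
    intro k
    induction k with
    | zero =>
      refine ⟨?_, hu, hi⟩
      have h := eq_of_dist_eq_of_im_ne_zero (h0 (block 0 (A.L 0).origin))
        (bar .origin_unit hu (A.L 0).curve_unit) (bar .origin_input hi (A.L 0).curve_input) ?_
      · exact h.trans (A.L 0).curve_origin
      · intro t
        have := inputCurve_im_pos t
        simp only [curve, PlanarLinkage.curve_origin]
        simpa using this.ne'
    | succ k ih =>
      obtain ⟨ho, hu, hi⟩ := ih
      have mu := hmu k ho hu
      have mi := hmi k ho hi
      refine ⟨?_, ?_, ?_⟩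
      · rw [← (A.L (k + 1)).curve_origin]
        exact Curve.eq_of_dist_eq_lineMap 2 (by rw [(A.L (k + 1)).curve_origin]; module)
          (bar (.origin_unit' k) hu (A.L k).curve_unit) (bar (.origin_midUnit k) mu rfl)
      · rw [← (A.L (k + 1)).curve_unit]
        exact Curve.eq_of_dist_eq_lineMap 2 (by rw [(A.L (k + 1)).curve_unit]; module)
          (bar (.unit_origin k) ho (A.L k).curve_origin) (bar (.unit_midUnit k) mu rfl)
      · rw [← (A.L (k + 1)).curve_input]
        exact Curve.eq_of_dist_eq_lineMap 2 (by rw [(A.L (k + 1)).curve_input]; module)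
          (bar (.input_origin k) ho (A.L k).curve_origin) (bar (.input_midInput k) mi rfl)
  have hblock : ∀ k x, q (block k x) = (A.L k).curve x := fun k x =>
    congrFun ((A.L k).rigid (fun x => q (block k x)) (fun x => h0 _)
      (fun x y h => hd _ _ (.block k x y h)) ((base k).1.trans (A.L k).curve_origin.symm)
      ((base k).2.1.trans (A.L k).curve_unit.symm)
      ((base k).2.2.trans (A.L k).curve_input.symm)) x
  -- the target is at distance at most `2 * radius k` from the output of the block `V k`, in the
  -- motion `q` as in the given one
  have htarget : q target = c := by
    ext1 t
    rw [← dist_le_zero]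
    have hlim : Filter.Tendsto (fun k => 4 * A.radius k) Filter.atTop (nhds 0) := by
      simpa using A.tendsto_radius.const_mul 4
    refine ge_of_tendsto' hlim fun k => ?_
    have h1 : dist (q (elbow k) t) (q target t) = A.radius k :=
      (hd _ _ (.elbow_target k) t).trans (A.dist_target k t)
    have h2 : dist (q (elbow k) t) ((A.L k).curve (A.out k) t) = A.radius k :=
      (bar (.elbow_out k) (hblock k _) rfl t).trans (A.dist_out k t)
    have h3 := A.dist_out k t
    have h4 := A.dist_target k t
    have h5 := dist_triangle_left (q target t) ((A.L k).curve (A.out k) t) (q (elbow k) t)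
    have h6 := dist_triangle_left ((A.L k).curve (A.out k) t) (c t) (A.elbowCurve k t)
    have h7 := dist_triangle (q target t) ((A.L k).curve (A.out k) t) (c t)
    linarith
  funext v
  rcases v with _ | _ | ⟨k, x⟩ | k | k | k
  · exact hp
  · exact htarget
  · exact hblock k x
  · exact hmu k (base k).1 (base k).2.1
  · exact hmi k (base k).1 (base k).2.2
  · exact eq_of_dist_eq_of_im_ne_zero (h0 _) (bar (.elbow_out k) (hblock k _) rfl)
      (bar (.elbow_target k) htarget rfl) (A.im_ne_zero k)

/-- The infinite linkage which draws the curve `c`. -/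
noncomputable def linkage : PlanarLinkage (ChainVertex A.V) where
  adj := A.Adj
  curve := A.curve
  origin := pivot
  unit := block 0 (A.L 0).unit
  input := block 0 (A.L 0).input
  curve_origin := rfl
  curve_unit := (A.L 0).curve_unit
  curve_input := (A.L 0).curve_input
  bar _ _ h := A.isBar_of_adj h
  rigid q h0 hd hp hu hi := A.rigid_of_adj q h0 hd hp (hu.trans (A.L 0).curve_unit)
    (hi.trans (A.L 0).curve_input)

theorem neighborSet_pivot : (SimpleGraph.fromRel A.Adj).neighborSet pivot =
    {block 0 (A.L 0).unit, block 0 (A.L 0).input} := by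
  ext v
  rw [SimpleGraph.mem_neighborSet, SimpleGraph.fromRel_adj]
  constructor
  · rintro ⟨-, h | h⟩
    · cases h <;> simp
    · cases h
  · rintro (rfl | rfl)
    · exact ⟨by simp, .inl .pivot_unit⟩
    · exact ⟨by simp, .inl .pivot_input⟩

theorem finite_neighborSet {v : ChainVertex A.V} (hv : v ≠ target) :
    ((SimpleGraph.fromRel A.Adj).neighborSet v).Finite := by
  refine (finite_level_le A.finite (v.level + 1)).subset fun u hu => ?_
  rw [SimpleGraph.mem_neighborSet, SimpleGraph.fromRel_adj] at hu
  rw [Set.mem_ofPred_eq]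
  rcases hu.2 with h | h
  · cases h <;> simp only [level] <;> omega
  · cases h <;> first | exact absurd rfl hv | (simp only [level]; omega)

theorem tendsto_elbowCurve (t : unitInterval) :
    Filter.Tendsto (fun k => A.elbowCurve k t) Filter.atTop (nhds (c t)) := by
  rw [tendsto_iff_dist_tendsto_zero]
  simpa only [A.dist_target] using A.tendsto_radius

end Approximation

/-! ### Linkages as frameworks in the Euclidean plane -/

namespace PlanarLinkage

variable {V : Type} (T : PlanarLinkage V)

/-- The framework underlying a linkage, placed in the Euclidean plane. -/
noncomputable def framework : Framework V where
  graph := SimpleGraph.fromRel T.adj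
  pos v := Complex.orthonormalBasisOneI.repr (T.curve v 0)

/-- The motion of the framework underlying a linkage. -/
noncomputable def motion (t : unitInterval) (v : V) : EuclideanSpace ℝ (Fin 2) :=
  Complex.orthonormalBasisOneI.repr (T.curve v t)

theorem dist_motion (t : unitInterval) (u v : V) :
    dist (T.motion t u) (T.motion t v) = dist (T.curve u t) (T.curve v t) :=
  Complex.orthonormalBasisOneI.repr.dist_map _ _

theorem unit_ne_input : T.unit ≠ T.input := by
  intro h
  have h1 := congrArg T.curve h
  rw [T.curve_unit, T.curve_input] at h1
  have h2 := congrArg Complex.im (DFunLike.congr_fun h1 0)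
  exact (inputCurve_im_pos 0).ne h2

theorem motion_one_input_ne : T.motion 1 T.input ≠ T.motion 0 T.input := by
  intro h
  have h1 := Complex.orthonormalBasisOneI.repr.injective h
  rw [T.curve_input] at h1
  have h2 := congrArg Complex.re h1
  rw [inputCurve_re, inputCurve_re] at h2
  norm_num at h2

theorem isContinuousFlex_motion
    (hN : (SimpleGraph.fromRel T.adj).neighborSet T.origin = {T.unit, T.input}) :
    T.framework.IsContinuousFlex T.motion where
  start := rfl
  continuous v := Complex.orthonormalBasisOneI.repr.continuous.comp (T.curve v).continuous
  base := by
    refine ⟨T.origin, T.unit, ?_, ?_, fun t => ⟨?_, ?_⟩⟩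
    · have : T.unit ∈ (SimpleGraph.fromRel T.adj).neighborSet T.origin := by
        rw [hN]
        exact .inl rfl
      exact this
    · rw [framework]
      refine fun h => zero_ne_one (α := ℂ) ?_
      simpa [T.curve_origin, T.curve_unit] using Complex.orthonormalBasisOneI.repr.injective h
    · simp [motion, T.curve_origin]
    · simp [motion, T.curve_unit]
  edge u v huv t := by
    rw [dist_motion, dist_motion]
    rcases (SimpleGraph.fromRel_adj _ _ _).1 huv with ⟨-, h | h⟩
    · exact T.bar u v h t
    · rw [dist_comm, dist_comm (T.curve u 0)]
      exact T.bar v u h t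
  nonconstant := ⟨1, fun h => T.motion_one_input_ne (congrFun h T.input)⟩

theorem motion_unique {q : unitInterval → V → EuclideanSpace ℝ (Fin 2)}
    (hq : T.framework.IsContinuousFlex q)
    (h : ∀ t, q t T.origin = T.motion t T.origin ∧ q t T.unit = T.motion t T.unit ∧
      q t T.input = T.motion t T.input) : q = T.motion := by
  let φ := Complex.orthonormalBasisOneI.repr
  let r : V → Curve := fun v => ⟨fun t => φ.symm (q t v), φ.symm.continuous.comp (hq.continuous v)⟩
  have hr : ∀ v t, φ (r v t) = q t v := fun v t => φ.apply_symm_apply _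
  have hrm : ∀ v t, q t v = T.motion t v → r v t = T.curve v t := fun v t h =>
    φ.injective ((hr v t).trans h)
  have key : r = T.curve := by
    refine T.rigid r (fun v => hrm v 0 (congrFun hq.start v)) (fun u v huv t => ?_)
      (ContinuousMap.ext fun t => hrm _ t (h t).1) (ContinuousMap.ext fun t => hrm _ t (h t).2.1)
      (ContinuousMap.ext fun t => hrm _ t (h t).2.2)
    by_cases huv' : u = v
    · rw [huv', dist_self, dist_self]
    · have h1 := hq.edge u v ((SimpleGraph.fromRel_adj _ _ _).2 ⟨huv', .inl huv⟩) t
      rw [hq.start] at h1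
      rw [T.bar u v huv t, ← φ.dist_map, hr, hr, h1]
      exact φ.dist_map _ _
  funext t v
  rw [← hr, key]
  rfl

/-- A linkage determined by its inputs is connected: otherwise the component of a vertex not joined
to the inputs could be translated independently of them. -/
theorem connected
    (hN : (SimpleGraph.fromRel T.adj).neighborSet T.origin = {T.unit, T.input}) :
    T.framework.graph.Connected := by
  classical
  have hflex := T.isContinuousFlex_motion hN
  have hadj : ∀ v ∈ ({T.unit, T.input} : Set V), T.framework.graph.Adj T.origin v := by
    rw [← hN]
    exact fun v hv => hv
  have hreach : ∀ v, T.framework.graph.Reachable T.origin v := by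
    intro v
    by_contra hv
    let e : EuclideanSpace ℝ (Fin 2) := Complex.orthonormalBasisOneI.repr 1
    let q : unitInterval → V → EuclideanSpace ℝ (Fin 2) := fun t u =>
      if T.framework.graph.Reachable T.origin u then T.motion t u else T.motion t u + (t : ℝ) • e
    have hq1 : ∀ {u}, T.framework.graph.Reachable T.origin u → ∀ t, q t u = T.motion t u :=
      fun hu t => if_pos hu
    have hq2 : ∀ {u}, ¬T.framework.graph.Reachable T.origin u →
        ∀ t, q t u = T.motion t u + (t : ℝ) • e := fun hu t => if_neg hu
    have hu : T.framework.graph.Reachable T.origin T.unit := (hadj _ (.inl rfl)).reachable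
    have hi : T.framework.graph.Reachable T.origin T.input := (hadj _ (.inr rfl)).reachable
    have hq0 : q 0 = T.motion 0 := by
      funext u
      by_cases h : T.framework.graph.Reachable T.origin u
      · exact hq1 h 0
      · simp [hq2 h]
    have hq : T.framework.IsContinuousFlex q := by
      refine ⟨hq0, fun u => ?_, ?_, fun a b hab t => ?_, ?_⟩
      · by_cases h : T.framework.graph.Reachable T.origin u
        · simpa only [hq1 h] using hflex.continuous u
        · simp only [hq2 h]
          have := hflex.continuous u
          fun_prop
      · refine ⟨T.origin, T.unit, hadj _ (.inl rfl), ?_, fun t => ?_⟩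
        · intro h
          have := Complex.orthonormalBasisOneI.repr.injective h
          rw [T.curve_origin, T.curve_unit] at this
          exact zero_ne_one this
        · rw [hq1 (.refl _), hq1 (.refl _), hq1 hu, hq1 hu]
          simp [motion, T.curve_origin, T.curve_unit]
      · rw [hq0]
        have hdist := hflex.edge a b hab t
        by_cases h : T.framework.graph.Reachable T.origin a
        · rw [hq1 h, hq1 (h.trans hab.reachable), hdist]
        · have h' : ¬T.framework.graph.Reachable T.origin b := fun h' =>
            h (h'.trans hab.symm.reachable)
          rw [hq2 h, hq2 h', dist_add_right, hdist]
      · refine ⟨1, fun h => T.motion_one_input_ne ?_⟩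
        simpa only [hq1 hi] using congrFun h T.input
    have hqm := T.motion_unique hq fun t => ⟨hq1 (.refl _) t, hq1 hu t, hq1 hi t⟩
    have h1 := congrFun (congrFun hqm 1) v
    rw [hq2 hv] at h1
    have h2 : e = 0 := by simpa using h1
    have h3 : (1 : ℂ) = 0 := Complex.orthonormalBasisOneI.repr.map_eq_zero_iff.1 h2
    exact one_ne_zero h3
  exact (SimpleGraph.connected_iff_exists_forall_reachable _).2 ⟨T.origin, hreach⟩

theorem isPlaneLinkage
    (hN : (SimpleGraph.fromRel T.adj).neighborSet T.origin = {T.unit, T.input}) :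
    T.framework.IsPlaneLinkage T.origin T.unit T.input T.motion where
  connected := T.connected hN
  ne := T.unit_ne_input
  neighborSet_eq := hN
  flex := T.isContinuousFlex_motion hN
  strictMono_angle := by
    intro s t hst
    have hst' : (s : ℝ) < t := hst
    have key : ∀ t, inner ℝ (T.motion t T.unit - T.motion t T.origin)
        (T.motion t T.input - T.motion t T.origin) = (t : ℝ) / 2 := by
      intro t
      simp only [motion, T.curve_origin, T.curve_unit, T.curve_input, ContinuousMap.zero_apply,
        map_zero, sub_zero, LinearIsometryEquiv.inner_map_map, Complex.inner,
        ContinuousMap.one_apply, map_one, mul_one, inputCurve_re]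
    simp only [key]
    linarith
  unique q hq h := T.motion_unique hq h

end PlanarLinkage

/-! ### Realisation of continuous curves -/

theorem mainTheorem3 (γ : C(unitInterval, EuclideanSpace ℝ (Fin 2))) :
    ∃ V : Type, Countable V ∧ Infinite V ∧
      ∃ (F : Framework V) (v₁ v₂ v₃ w : V)
        (p : unitInterval → V → EuclideanSpace ℝ (Fin 2)),
        F.IsPlaneLinkage v₁ v₂ v₃ p ∧
        (∀ t, p t v₁ = 0) ∧
        (∀ t, p t v₂ = p 0 v₂) ∧
        (∀ v, v ≠ w → (F.graph.neighborSet v).Finite) ∧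
        (∃ u : ℕ → V, Function.Injective u ∧
          ∀ t, Filter.Tendsto (fun k => p t (u k)) Filter.atTop (nhds (p t w))) ∧
        ∀ t, p t w = γ t := by
  let φ := Complex.orthonormalBasisOneI.repr
  let c : Curve := ⟨fun t => φ.symm (γ t), φ.symm.continuous.comp γ.continuous⟩
  obtain ⟨A⟩ := exists_approximation c
  let T := A.linkage
  have hinj : Function.Injective (ChainVertex.elbow : ℕ → ChainVertex A.V) := fun _ _ h => by
    injection h
  refine ⟨ChainVertex A.V, ChainVertex.countable A.finite, Infinite.of_injective _ hinj,
    T.framework, T.origin, T.unit, T.input, .target, T.motion,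
    T.isPlaneLinkage A.neighborSet_pivot, fun t => ?_, fun t => ?_,
    fun v hv => A.finite_neighborSet hv, ⟨.elbow, hinj, fun t => ?_⟩, fun t => ?_⟩
  · simp [PlanarLinkage.motion, T.curve_origin]
  · simp [PlanarLinkage.motion, T.curve_unit]
  · exact (φ.continuous.tendsto _).comp (A.tendsto_elbowCurve t)
  · exact φ.apply_symm_apply (γ t)
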